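/- Let $(X,Y)$ be a random element of $\mathbb R^d\times\{0,1\}$, let $i\in\{1,\dots,d\}$, and let $y\in\{0,1\}$ with $\mathbb P(Y=y)>0$. Let $F_{i|y}(t)=\mathbb P(X_i\le t\mid Y=y)$. Let $X^{y,1},\dots,X^{y,n}$ be independent copies of $(X\mid Y=y)$, and let $\widehat F_{i|y}(t)=\frac1n\sum_{j=1}^n \mathbf 1\{X^{y,j}_i\le t\}$. Let $\Phi$ and $\phi$ be the distribution function and the density of $N(0,1)$, and let $\Phi^{-1}$ be its quantile function, with values in $[-\infty,\infty]$, so that $\Phi^{-1}(0)=-\infty$ and $\Phi^{-1}(1)=+\infty$. Put $$\alpha_{i|y}(t)=\Phi^{-1}(F_{i|y}(t)),\qquad \widehat\alpha_{i|y}(t)=\Phi^{-1}(\widehat F_{i|y}(t)).$$ Let $0<\gamma<2$, let $a_n=\sqrt{\gamma\log n}$ and $g(n,\gamma)=\phi(a_n)/(2a_n)$, and assume that $a_n\ge1$. Then for every $0<\epsilon\le\sqrt{2\pi}$ and every $t\in\mathbb R$ with $\alpha_{i|y}(t)\in[-a_n,a_n]$, $$\begin{aligned} &\mathbb P\left(|\widehat\alpha_{i|y}(t)-\alpha_{i|y}(t)|\ge\epsilon\right)\\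 &\quad\le 2\exp\left(-\frac{\min\{F_{i|y}(t),1-F_{i|y}(t)\}}{6\pi}\,n\epsilon^2\right)+6\log\left(\frac{g(n,\gamma)^{-1}}{2}\right)\exp\left(-\frac{1}{32}\,n\,g(n,\gamma)\right)\\ &\quad\le 2\exp\left(-J_1\frac{n^{1-\gamma/2}\epsilon^2}{\sqrt{\gamma\log n}}\right)+6\log\left(\frac{g(n,\gamma)^{-1}}{2}\right)\exp\left(-\frac{1}{32}\,n\,g(n,\gamma)\right), \end{aligned}$$ where $J_1=(12\pi\sqrt{2\pi})^{-1}$. -/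

import Mathlib

open MeasureTheory ProbabilityTheory Real

noncomputable section

namespace GaussianCopula

/-- The distribution function `Φ` of the standard normal law `N(0,1)`. -/
def Phi (x : ℝ) : ℝ := cdf (gaussianReal 0 1) x

/-- The quantile function `Φ⁻¹(p) = inf {x ∈ ℝ : p ≤ Φ(x)}` of `N(0,1)`, with values in the
extended real line, so that `Φ⁻¹(0) = -∞` and `Φ⁻¹(1) = +∞`. -/
def PhiInv (p : ℝ) : EReal := sInf ((fun x : ℝ => (x : EReal)) '' {x : ℝ | p ≤ Phi x})

/-- The density `φ` of `N(0,1)`. -/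
def phi (x : ℝ) : ℝ := gaussianPDFReal 0 1 x

/-- `a_n = √(γ log n)`. -/
def a (n : ℕ) (γ : ℝ) : ℝ := √(γ * Real.log n)

/-- `g(n, γ) = φ(a_n) / (2 a_n)`. -/
def g (n : ℕ) (γ : ℝ) : ℝ := phi (a n γ) / (2 * a n γ)

/-- The distribution function `F_{i|y}(t) = P(X_i ≤ t | Y = y)` of the `i`-th coordinate for
class `y`. -/
def F {E : Type*} [MeasurableSpace E] (P : Measure E) {d : ℕ} (X : E → Fin d → ℝ)
    (Y : E → Fin 2) (i : Fin d) (y : Fin 2) (t : ℝ) : ℝ :=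
  (cond P {e | Y e = y}).real {e | X e i ≤ t}

/-- The transformation function `α_{i|y}(t) = Φ⁻¹(F_{i|y}(t))`. -/
def alpha {E : Type*} [MeasurableSpace E] (P : Measure E) {d : ℕ} (X : E → Fin d → ℝ)
    (Y : E → Fin 2) (i : Fin d) (y : Fin 2) (t : ℝ) : EReal :=
  PhiInv (F P X Y i y t)

/-- The empirical distribution function at `t` of the `i`-th coordinates of the points
`x 0, …, x (n - 1)` of `ℝ^d`. -/
def FHat {n d : ℕ} (x : Fin n → Fin d → ℝ) (i : Fin d) (t : ℝ) : ℝ :=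
  (1 / (n : ℝ)) * ∑ j : Fin n, Set.indicator {v : Fin d → ℝ | v i ≤ t} (fun _ => (1 : ℝ)) (x j)

/-- The estimator `Φ⁻¹(FHat(t))` of the transformation function, computed from the points
`x 0, …, x (n - 1)`. -/
def alphaHat {n d : ℕ} (x : Fin n → Fin d → ℝ) (i : Fin d) (t : ℝ) : EReal :=
  PhiInv (FHat x i t)

/-- The constant `J₁ = (12 π √(2π))⁻¹`. -/
def J₁ : ℝ := (12 * π * √(2 * π))⁻¹

end GaussianCopula

end

namespace GaussianCopula

open Filter Topology

/-! Since `α(t) = x` is finite, `F(t) = Φ(x)`, and an error of at least `ε` forces the empirical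
frequency to be at least `Φ(x + ε)` or at most `Φ(x - ε)`. Passing to complements turns the second
case into the first with `-x`, so one Chernoff bound serves both (`real_le_sum_indicator_le`).

With `p = Φ(x)` and `q = Φ(x + ε)`, the entropy exponent is at least `(q - p)² / (2q(1 - p))`. It
remains to compare this with `min(p, 1 - p) ε² / (6π)` (`min_mul_sq_le_exponent`): the normal hazard
rate is at least `√(2/π)`, so tails shrink by a definite factor over a step `ε`.

The logarithmic term is nonnegative slack. The second inequality is the Mills bound `Φ(-a_n) ≥
φ(a_n)/(2a_n)`. -/

/-! ### Normal density, distribution function and tails -/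

lemma phi_eq (x : ℝ) : phi x = (√(2 * π))⁻¹ * exp (-x ^ 2 / 2) := by
  simp [phi, gaussianPDFReal]

lemma phi_pos (x : ℝ) : 0 < phi x := by
  rw [phi_eq]; positivity

lemma hasDerivAt_phi (x : ℝ) : HasDerivAt phi (-x * phi x) x := by
  have h : HasDerivAt (fun x : ℝ => (√(2 * π))⁻¹ * exp (-x ^ 2 / 2))
      ((√(2 * π))⁻¹ * (exp (-x ^ 2 / 2) * (-(2 * x) / 2))) x := by
    refine HasDerivAt.const_mul _ (HasDerivAt.exp ?_)
    simpa using ((hasDerivAt_pow 2 x).neg.div_const 2)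
  have e : phi = fun x : ℝ => (√(2 * π))⁻¹ * exp (-x ^ 2 / 2) := funext phi_eq
  rw [e]
  convert h using 1
  ring

lemma continuous_phi : Continuous phi :=
  continuous_iff_continuousAt.2 fun x => (hasDerivAt_phi x).continuousAt

lemma integrable_phi : Integrable phi := integrable_gaussianPDFReal 0 1

lemma Phi_eq_integral (x : ℝ) : Phi x = ∫ u in Set.Iic x, phi u := by
  rw [Phi, cdf_eq_real, measureReal_def, gaussianReal_apply_eq_integral 0 one_ne_zero,
    ENNReal.toReal_ofReal]
  · rfl
  · exact integral_nonneg fun u => gaussianPDFReal_nonneg 0 1 u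

lemma hasDerivAt_Phi (x : ℝ) : HasDerivAt Phi (phi x) x := by
  have h : HasDerivAt (fun y => Phi 0 + ∫ u in (0 : ℝ)..y, phi u) (phi x) x :=
    (intervalIntegral.integral_hasDerivAt_right (continuous_phi.intervalIntegrable _ _)
      (continuous_phi.stronglyMeasurableAtFilter _ _) continuous_phi.continuousAt).const_add _
  have e : Phi = fun y => Phi 0 + ∫ u in (0 : ℝ)..y, phi u := by
    funext y
    rw [Phi_eq_integral y, Phi_eq_integral 0, ← intervalIntegral.integral_Iic_sub_Iic
      integrable_phi.integrableOn integrable_phi.integrableOn]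
    ring
  rw [e]
  exact h

lemma continuous_Phi : Continuous Phi :=
  continuous_iff_continuousAt.2 fun x => (hasDerivAt_Phi x).continuousAt

lemma strictMono_Phi : StrictMono Phi :=
  strictMono_of_hasDerivAt_pos (fun x => hasDerivAt_Phi x) phi_pos

lemma Phi_pos (x : ℝ) : 0 < Phi x :=
  (cdf_nonneg _ (x - 1)).trans_lt (strictMono_Phi (sub_one_lt x))

lemma Phi_lt_one (x : ℝ) : Phi x < 1 :=
  (strictMono_Phi (lt_add_one x)).trans_le (cdf_le_one _ _)

lemma Phi_neg (x : ℝ) : Phi (-x) = 1 - Phi x := by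
  have h1 : Phi (-x) = ∫ u in Set.Ioi x, phi u := by
    rw [Phi_eq_integral, ← integral_comp_neg_Ioi]
    simp [phi_eq]
  have h2 := integral_add_compl (measurableSet_Iic (a := x)) integrable_phi
  have h3 : ∫ u, phi u = 1 := integral_gaussianPDFReal_eq_one 0 one_ne_zero
  rw [Set.compl_Iic, ← h1, ← Phi_eq_integral, h3] at h2
  linarith

lemma Phi_zero : Phi 0 = 1 / 2 := by
  have := Phi_neg 0
  rw [neg_zero] at this
  linarith

lemma tendsto_Phi_atTop : Tendsto Phi atTop (𝓝 1) := tendsto_cdf_atTop _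

lemma tendsto_phi_atTop : Tendsto phi atTop (𝓝 0) := by
  have h : Tendsto (fun x : ℝ => -x ^ 2 / 2) atTop atBot := by
    have := (tendsto_pow_atTop (α := ℝ) two_ne_zero).atTop_div_const (zero_lt_two)
    exact (tendsto_neg_atTop_atBot.comp this).congr fun x => (neg_div _ _).symm
  have h2 := (tendsto_exp_atBot.comp h).const_mul (√(2 * π))⁻¹
  rw [mul_zero] at h2
  exact h2.congr fun x => (phi_eq x).symm

/-- A function that decreases to its limit `0` on a half line is nonnegative there. -/
lemma nonneg_of_hasDerivAt_nonpos_of_tendsto_zero {f f' : ℝ → ℝ} {b : ℝ}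
    (hf : ∀ x, b ≤ x → HasDerivAt f (f' x) x) (hf' : ∀ x, b ≤ x → f' x ≤ 0)
    (hlim : Tendsto f atTop (𝓝 0)) {x : ℝ} (hx : b ≤ x) : 0 ≤ f x := by
  have hanti : AntitoneOn f (Set.Ici b) :=
    antitoneOn_of_hasDerivWithinAt_nonpos (convex_Ici b)
      (fun z hz => (hf z hz).continuousAt.continuousWithinAt)
      (fun z hz => (hf z (interior_subset hz)).hasDerivWithinAt)
      (fun z hz => hf' z (interior_subset hz))
  exact le_of_tendsto hlim <| (eventually_ge_atTop x).mono fun z hz =>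
    hanti hx (Set.mem_Ici.2 (hx.trans hz)) hz

/-- Lower Mills ratio bound. -/
lemma phi_div_le_Phi_neg {x : ℝ} (hx : 1 ≤ x) : phi x / (2 * x) ≤ Phi (-x) := by
  have key : 0 ≤ (1 - Phi x) - phi x / (2 * x) := by
    refine nonneg_of_hasDerivAt_nonpos_of_tendsto_zero
      (f := fun x => (1 - Phi x) - phi x / (2 * x))
      (f' := fun x => -phi x - ((-x * phi x) * (2 * x) - phi x * 2) / (2 * x) ^ 2)
      (b := 1) ?_ ?_ ?_ hx
    · intro z hz
      have h2 : HasDerivAt (fun z : ℝ => 2 * z) 2 z := by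
        simpa using (hasDerivAt_id z).const_mul 2
      exact ((hasDerivAt_Phi z).const_sub 1).sub ((hasDerivAt_phi z).div h2 (by positivity))
    · intro z hz
      have hz0 : 0 < z := by linarith
      have e : -phi z - ((-z * phi z) * (2 * z) - phi z * 2) / (2 * z) ^ 2
          = -(phi z * (z ^ 2 - 1) / (2 * z ^ 2)) := by
        field_simp; ring
      rw [e, neg_nonpos]
      have := phi_pos z
      have : 0 ≤ z ^ 2 - 1 := by nlinarith
      positivity
    · have h1 : Tendsto (fun x => 1 - Phi x) atTop (𝓝 (1 - 1)) :=
        tendsto_const_nhds.sub tendsto_Phi_atTop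
      have h2 : Tendsto (fun x => phi x / (2 * x)) atTop (𝓝 0) :=
        tendsto_phi_atTop.div_atTop (tendsto_id.const_mul_atTop zero_lt_two)
      simpa using h1.sub h2
  rw [Phi_neg]
  linarith

/-- The hazard rate of the normal law is at least `√(2/π)` on the positive half line. -/
lemma sqrt_mul_Phi_neg_le_phi {x : ℝ} (hx : 0 ≤ x) : √(2 / π) * Phi (-x) ≤ phi x := by
  set c := √(2 / π) with hc
  have hc0 : 0 < c := by positivity
  have hd : ∀ z, HasDerivAt (fun x => phi x - c * (1 - Phi x)) ((c - z) * phi z) z := by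
    intro z
    refine ((hasDerivAt_phi z).sub
      (((hasDerivAt_Phi z).const_sub 1).const_mul c)).congr_deriv ?_
    ring
  have hphi0 : phi 0 = c * (1 / 2) := by
    have h4 : √(2 / π) * √(2 * π) = 2 := by
      rw [← sqrt_mul (by positivity)]
      have : 2 / π * (2 * π) = 2 ^ 2 := by field_simp
      rw [this, sqrt_sq (by norm_num)]
    have : 0 < √(2 * π) := by positivity
    rw [phi_eq, hc]
    have e : exp (-0 ^ 2 / 2) = 1 := by simp
    rw [e]
    field_simp
    linarith
  rw [Phi_neg]
  suffices 0 ≤ phi x - c * (1 - Phi x) by linarith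
  -- The derivative `(c - z) φ(z)` changes sign at `c`: the difference rises from its value `0` at
  -- the origin, then falls to its limit `0` at infinity.
  rcases le_total x c with h | h
  · have hmono : MonotoneOn (fun x => phi x - c * (1 - Phi x)) (Set.Icc 0 c) :=
      monotoneOn_of_hasDerivWithinAt_nonneg (convex_Icc 0 c)
        (fun z _ => (hd z).continuousAt.continuousWithinAt)
        (fun z _ => (hd z).hasDerivWithinAt)
        (fun z hz => mul_nonneg (sub_nonneg.2 (interior_subset hz).2) (phi_pos z).le)
    have := hmono ⟨le_rfl, hc0.le⟩ ⟨hx, h⟩ hx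
    simp only [Phi_zero, hphi0] at this
    linarith
  · refine nonneg_of_hasDerivAt_nonpos_of_tendsto_zero (b := c) (fun z _ => hd z)
      (fun z hz => mul_nonpos_of_nonpos_of_nonneg (sub_nonpos.2 hz) (phi_pos z).le) ?_ h
    have h1 : Tendsto (fun x => 1 - Phi x) atTop (𝓝 (1 - 1)) :=
      tendsto_const_nhds.sub tendsto_Phi_atTop
    simpa using tendsto_phi_atTop.sub (h1.const_mul c)

/-- The upper tail of the normal law decays at least at the exponential rate `√(2/π)`. -/
lemma Phi_neg_add_le {x ε : ℝ} (hx : 0 ≤ x) (hε : 0 ≤ ε) :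
    Phi (-(x + ε)) ≤ exp (-(√(2 / π) * ε)) * Phi (-x) := by
  set c := √(2 / π)
  have hd : ∀ z, HasDerivAt (fun x => (1 - Phi x) * exp (c * x))
      (-phi z * exp (c * z) + (1 - Phi z) * (exp (c * z) * c)) z := by
    intro z
    have h : HasDerivAt (fun z : ℝ => c * z) c z := by
      simpa using (hasDerivAt_id z).const_mul c
    exact ((hasDerivAt_Phi z).const_sub 1).mul h.exp
  have hanti : AntitoneOn (fun x => (1 - Phi x) * exp (c * x)) (Set.Ici 0) :=
    antitoneOn_of_hasDerivWithinAt_nonpos (convex_Ici 0)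
      (fun z _ => (hd z).continuousAt.continuousWithinAt)
      (fun z _ => (hd z).hasDerivWithinAt)
      (fun z hz => by
        have h := sqrt_mul_Phi_neg_le_phi (x := z) (interior_subset hz)
        rw [Phi_neg] at h
        have := mul_le_mul_of_nonneg_right h (exp_pos (c * z)).le
        linarith)
  have h := hanti (Set.mem_Ici.2 hx) (Set.mem_Ici.2 (add_nonneg hx hε))
    (le_add_of_nonneg_right hε)
  simp only [mul_add, exp_add] at h
  rw [Phi_neg, Phi_neg]
  have e1 := exp_pos (c * x)
  have e2 : exp (-(c * ε)) * exp (c * ε) = 1 := by rw [← exp_add]; simp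
  have h' : (1 - Phi (x + ε)) * exp (c * ε) ≤ 1 - Phi x := by
    refine le_of_mul_le_mul_right ?_ e1
    linarith
  calc 1 - Phi (x + ε) = exp (-(c * ε)) * ((1 - Phi (x + ε)) * exp (c * ε)) := by
        linear_combination (-(1 - Phi (x + ε))) * e2
    _ ≤ _ := mul_le_mul_of_nonneg_left h' (exp_pos _).le

/-- A chord of the concave function `ε ↦ 1 - exp (-√(2/π) ε)` on `[0, √(2π)]`. -/
lemma div_sqrt_le_one_sub_exp {ε : ℝ} (hε0 : 0 ≤ ε) (hε : ε ≤ √(2 * π)) :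
    ε / √(3 * π) ≤ 1 - exp (-(√(2 / π) * ε)) := by
  have h4 : √(2 / π) * √(2 * π) = 2 := by
    rw [← sqrt_mul (by positivity)]
    have : 2 / π * (2 * π) = 2 ^ 2 := by field_simp
    rw [this, sqrt_sq (by norm_num)]
  have hs : 0 < √(2 * π) := by positivity
  set θ := ε / √(2 * π) with hθ
  have hθ0 : 0 ≤ θ := by positivity
  have hθ1 : θ ≤ 1 := (div_le_one hs).2 hε
  have hεθ : ε = θ * √(2 * π) := by rw [hθ]; field_simp
  have hconv := convexOn_exp.2 (Set.mem_univ (0 : ℝ)) (Set.mem_univ (-2 : ℝ))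
    (sub_nonneg.2 hθ1) hθ0 (by ring)
  simp only [smul_eq_mul, mul_zero, zero_add, exp_zero, mul_one] at hconv
  have e1 : -(√(2 / π) * ε) = θ * -2 := by
    rw [hεθ]; linear_combination (-θ) * h4
  -- This gives chord slope at least `17/20` in `θ`, enough because `(17/20)² · 3 ≥ 2`.
  have e2 : exp (-2) ≤ 3 / 20 := by
    have h1 : exp (-2) = exp (-1) ^ 2 := by rw [← exp_nat_mul]; norm_num
    have h2 := exp_neg_one_lt_d9
    have h3 := exp_pos (-1)
    rw [h1]
    nlinarith
  have e3 : ε / √(3 * π) ≤ θ * (17 / 20) := by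
    have h5 : √(2 * π) ≤ 17 / 20 * √(3 * π) := by
      refine sqrt_le_iff.2 ⟨by positivity, ?_⟩
      rw [mul_pow, sq_sqrt (by positivity)]
      nlinarith [pi_pos]
    rw [div_le_iff₀ (by positivity), hεθ]
    nlinarith
  rw [e1]
  nlinarith

/-! ### Chernoff bound for Bernoulli sums -/

/-- A lower bound for the relative entropy of two Bernoulli laws. -/
lemma sq_div_le_bernoulli_entropy {p q : ℝ} (hp : 0 < p) (hpq : p ≤ q) (hq : q < 1) :
    (q - p) ^ 2 / (2 * (q * (1 - p)))
      ≤ q * (log q - log p) + (1 - q) * (log (1 - q) - log (1 - p)) := by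
  set v := 2 * (q * (1 - p)) with hv
  have hq0 : 0 < q := by linarith
  have hv0 : 0 < v := by
    have : 0 < 1 - p := by linarith
    positivity
  have hd : ∀ s ∈ Set.Icc p q, HasDerivAt
      (fun s => q * (log q - log s) + (1 - q) * (log (1 - q) - log (1 - s)) - (q - s) ^ 2 / v)
      (q * (-s⁻¹) + (1 - q) * (-(-1 / (1 - s))) - 2 * (q - s) * (-1) / v) s := by
    intro s hs
    have hs0 : s ≠ 0 := by linarith [hs.1]
    have hs1 : 1 - s ≠ 0 := by linarith [hs.2]
    have h1 := ((hasDerivAt_log hs0).const_sub (log q)).const_mul q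
    have h2 := ((((hasDerivAt_id s).const_sub 1).log hs1).const_sub (log (1 - q))).const_mul (1 - q)
    have h3 := ((((hasDerivAt_id s).const_sub q).pow 2).div_const v)
    refine ((h1.add h2).sub h3).congr_deriv ?_
    simp
  have hanti : AntitoneOn
      (fun s => q * (log q - log s) + (1 - q) * (log (1 - q) - log (1 - s)) - (q - s) ^ 2 / v)
      (Set.Icc p q) := by
    refine antitoneOn_of_hasDerivWithinAt_nonpos (convex_Icc p q)
      (fun s hs => (hd s hs).continuousAt.continuousWithinAt)
      (fun s hs => (hd s (interior_subset hs)).hasDerivWithinAt) (fun s hs => ?_)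
    obtain ⟨hs1, hs2⟩ := interior_subset hs
    have a1 : 0 < s := by linarith
    have a2 : 0 < 1 - s := by linarith
    have e : q * (-s⁻¹) + (1 - q) * (-(-1 / (1 - s))) - 2 * (q - s) * (-1) / v
        = (q - s) * (2 / v - 1 / (s * (1 - s))) := by
      field_simp; ring
    rw [e]
    -- For `p ≤ s ≤ q`, `s(1 - s) ≤ q(1 - p) = v / 2`.
    refine mul_nonpos_of_nonneg_of_nonpos (by linarith) (sub_nonpos.2 ?_)
    rw [div_le_div_iff₀ hv0 (by positivity), hv]
    nlinarith [mul_le_mul hs2 (sub_le_sub_left hs1 1) a2.le hq0.le]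
  have := hanti ⟨le_rfl, hpq⟩ ⟨hpq, le_rfl⟩ hpq
  simp only [sub_self, mul_zero, add_zero, ne_eq, OfNat.ofNat_ne_zero, not_false_eq_true, zero_pow,
    zero_div] at this
  linarith

section

variable {Ω : Type*} [MeasurableSpace Ω] {Q : Measure Ω} [IsProbabilityMeasure Q]

lemma mgf_indicator {A : Set Ω} (hA : NullMeasurableSet A Q) (l : ℝ) :
    mgf (A.indicator fun _ => (1 : ℝ)) Q l = 1 - Q.real A + Q.real A * exp l := by
  have e : ∀ ω, exp (l * A.indicator (fun _ => (1 : ℝ)) ω)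
      = A.indicator (fun _ => exp l - 1) ω + 1 := by
    intro ω
    by_cases hω : ω ∈ A <;> simp [hω]
  simp only [mgf, e]
  rw [integral_add ((integrable_const _).indicator₀ hA) (integrable_const _),
    integral_indicator₀ hA]
  simp
  ring

/-- Chernoff's bound for the number of successes in independent trials, in a form of Bernstein
type. -/
lemma real_le_sum_indicator_le {n : ℕ} {A : Fin n → Set Ω} {p q : ℝ}
    (hA : ∀ j, NullMeasurableSet (A j) Q)
    (hind : iIndepFun (fun j => (A j).indicator fun _ => (1 : ℝ)) Q)
    (hAp : ∀ j, Q.real (A j) = p) (hp : 0 < p) (hpq : p ≤ q) (hq : q < 1) :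
    Q.real {ω | n * q ≤ ∑ j, (A j).indicator (fun _ => (1 : ℝ)) ω}
      ≤ exp (-(n * ((q - p) ^ 2 / (2 * (q * (1 - p)))))) := by
  have hq0 : 0 < q := by linarith
  have hq1 : 0 < 1 - q := by linarith
  have hp1 : 0 < 1 - p := by linarith
  -- The optimal tilt: the log odds ratio of `q` to `p`.
  set l := log q - log p + (log (1 - p) - log (1 - q)) with hl
  have hl0 : 0 ≤ l := by
    have h1 := log_le_log hp hpq
    have h2 := log_le_log hq1 (sub_le_sub_left hpq 1)
    linarith
  have hmeas : ∀ j, AEMeasurable ((A j).indicator fun _ => (1 : ℝ)) Q := fun j =>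
    aemeasurable_const.indicator₀ (hA j)
  have hint : Integrable
      (fun ω => exp (l * (∑ j, (A j).indicator fun _ => (1 : ℝ)) ω)) Q := by
    refine Integrable.of_bound (C := exp (l * n))
      ((Finset.aemeasurable_sum _ fun j _ => hmeas j).const_mul l).exp.aestronglyMeasurable
      (Filter.Eventually.of_forall fun ω => ?_)
    rw [norm_of_nonneg (exp_pos _).le, exp_le_exp, Finset.sum_apply]
    refine mul_le_mul_of_nonneg_left ?_ hl0
    refine (Finset.sum_le_sum fun j _ =>
      Set.indicator_le_self' (fun _ _ => zero_le_one) ω).trans ?_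
    simp
  have h := measure_ge_le_exp_mul_mgf (n * q) hl0 hint
  rw [hind.mgf_sum₀ hmeas] at h
  simp only [mgf_indicator (hA _), hAp, Finset.prod_const, Finset.card_univ, Fintype.card_fin,
    Finset.sum_apply] at h
  refine h.trans ?_
  have hexp : exp l = q * (1 - p) / (p * (1 - q)) := by
    rw [hl, exp_add, exp_sub, exp_sub, exp_log hq0, exp_log hp, exp_log hp1, exp_log hq1]
    field_simp
  have hm : 1 - p + p * exp l = exp (log (1 - p) - log (1 - q)) := by
    rw [hexp, exp_sub, exp_log hp1, exp_log hq1]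
    field_simp
    ring
  rw [hm, ← exp_nat_mul, ← exp_add, exp_le_exp]
  have hk := mul_le_mul_of_nonneg_left (sq_div_le_bernoulli_entropy hp hpq hq)
    (Nat.cast_nonneg' (α := ℝ) n)
  rw [hl]
  linarith

end

/-! ### From the entropy exponent to a quadratic in `ε` -/

/-- The Chernoff exponent between the levels `Phi x` and `Phi (x + ε)` is at least quadratic. -/
lemma min_mul_sq_le_exponent {x ε : ℝ} (hε0 : 0 ≤ ε) (hε : ε ≤ √(2 * π)) :
    min (Phi x) (1 - Phi x) / (6 * π) * ε ^ 2
      ≤ (Phi (x + ε) - Phi x) ^ 2 / (2 * (Phi (x + ε) * (1 - Phi x))) := by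
  have hchord := div_sqrt_le_one_sub_exp hε0 hε
  set κ := ε / √(3 * π) with hκ
  set η := exp (-(√(2 / π) * ε)) with hη
  have hκ0 : 0 ≤ κ := by positivity
  have hκ2 : κ ^ 2 = ε ^ 2 / (3 * π) := by rw [hκ, div_pow, sq_sqrt (by positivity)]
  have hp0 := Phi_pos x
  have hp1 := Phi_lt_one x
  have hq0 := Phi_pos (x + ε)
  have hq1 := Phi_lt_one (x + ε)
  have hpq : Phi x ≤ Phi (x + ε) := strictMono_Phi.monotone (le_add_of_nonneg_right hε0)
  have e : min (Phi x) (1 - Phi x) / (6 * π) * ε ^ 2 = min (Phi x) (1 - Phi x) * κ ^ 2 / 2 := by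
    rw [hκ2]; field_simp; ring
  have hp1' : 0 < 1 - Phi x := by linarith
  rw [e, le_div_iff₀ (by positivity)]
  have hmin0 : 0 ≤ min (Phi x) (1 - Phi x) := le_min hp0.le hp1'.le
  suffices min (Phi x) (1 - Phi x) * (Phi (x + ε) * (1 - Phi x)) * κ ^ 2
      ≤ (Phi (x + ε) - Phi x) ^ 2 by linarith
  -- If `x` and `x + ε` lie on the same side of `0`, the tail farther from `0` is at most `η` times
  -- the nearer one; otherwise the decay is split at `0`.
  rcases le_total 0 x with hx | hx
  · have h := Phi_neg_add_le hx hε0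
    rw [Phi_neg, Phi_neg] at h
    have h1 : (1 - Phi x) * κ ≤ Phi (x + ε) - Phi x := by nlinarith
    calc _ ≤ (1 - Phi x) * (1 * (1 - Phi x)) * κ ^ 2 := by
          gcongr
          exact min_le_right _ _
      _ = ((1 - Phi x) * κ) ^ 2 := by ring
      _ ≤ _ := pow_le_pow_left₀ (by positivity) h1 2
  rcases le_total 0 (x + ε) with hy | hy
  · have ha := Phi_neg_add_le le_rfl hy
    have hb := Phi_neg_add_le le_rfl (neg_nonneg.2 hx)
    simp only [zero_add, neg_zero, neg_neg, Phi_zero] at ha hb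
    rw [Phi_neg] at ha
    have h1 : κ / 2 ≤ Phi (x + ε) - Phi x := by
      set u := exp (-(√(2 / π) * (x + ε)))
      set w := exp (-(√(2 / π) * -x))
      have huw : u * w = η := by rw [← exp_add, hη]; ring_nf
      have hu : u ≤ 1 := exp_le_one_iff.2 (neg_nonpos.2 (by positivity))
      have hw : w ≤ 1 :=
        exp_le_one_iff.2 (neg_nonpos.2 (mul_nonneg (sqrt_nonneg _) (neg_nonneg.2 hx)))
      -- `q - p ≥ 1 - (u + w)/2 ≥ (1 - uw)/2`, the gap being `(1 - u)(1 - w)/2`.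
      nlinarith [mul_nonneg (sub_nonneg.2 hu) (sub_nonneg.2 hw)]
    have h2 : Phi x * (1 - Phi x) ≤ 1 / 4 := by nlinarith [sq_nonneg (Phi x - 1 / 2)]
    calc _ ≤ Phi x * (1 * (1 - Phi x)) * κ ^ 2 := by
          gcongr
          exact min_le_left _ _
      _ = Phi x * (1 - Phi x) * κ ^ 2 := by ring
      _ ≤ 1 / 4 * κ ^ 2 := mul_le_mul_of_nonneg_right h2 (sq_nonneg κ)
      _ = (κ / 2) ^ 2 := by ring
      _ ≤ _ := pow_le_pow_left₀ (by positivity) h1 2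
  · have h := Phi_neg_add_le (neg_nonneg.2 hy) hε0
    have e1 : -(-(x + ε) + ε) = x := by ring
    rw [e1, neg_neg] at h
    have h1 : Phi (x + ε) * κ ≤ Phi (x + ε) - Phi x := by nlinarith
    calc _ ≤ Phi (x + ε) * (Phi (x + ε) * 1) * κ ^ 2 := by
          gcongr
          · exact (min_le_left _ _).trans hpq
          · linarith
      _ = (Phi (x + ε) * κ) ^ 2 := by ring
      _ ≤ _ := pow_le_pow_left₀ (by positivity) h1 2

/-! ### Quantile inversion and the sample -/

/-- If `p < Φ(z)`, continuity gives `w < z` with `p < Φ(w)`, so the infimum lies below `z`. No range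
condition on `p` is needed, which covers empirical frequencies `0` and `1`. -/
lemma Phi_le_of_le_PhiInv {z p : ℝ} (h : (z : EReal) ≤ PhiInv p) : Phi z ≤ p := by
  by_contra! hlt
  obtain ⟨w, hw, hpw⟩ := ((continuous_Phi.tendsto z).eventually (lt_mem_nhds hlt)
    |>.filter_mono nhdsWithin_le_nhds |>.and self_mem_nhdsWithin :
      ∀ᶠ w in nhdsWithin z (Set.Iio z), p < Phi w ∧ w ∈ Set.Iio z).exists
  have h1 : PhiInv p ≤ (w : EReal) := sInf_le (Set.mem_image_of_mem _ hw.le)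
  exact absurd (EReal.coe_le_coe_iff.1 (h.trans h1)) (not_le.2 hpw)

lemma le_Phi_of_PhiInv_le {z p : ℝ} (h : PhiInv p ≤ (z : EReal)) : p ≤ Phi z := by
  by_contra! hlt
  obtain ⟨w, hw, hpw⟩ := ((continuous_Phi.tendsto z).eventually (gt_mem_nhds hlt)
    |>.filter_mono nhdsWithin_le_nhds |>.and self_mem_nhdsWithin :
      ∀ᶠ w in nhdsWithin z (Set.Ioi z), Phi w < p ∧ w ∈ Set.Ioi z).exists
  have h1 : (w : EReal) ≤ PhiInv p := by
    refine le_sInf ?_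
    rintro _ ⟨u, hu, rfl⟩
    exact EReal.coe_le_coe_iff.2 (strictMono_Phi.le_iff_le.1 (hw.le.trans hu))
  exact absurd (EReal.coe_le_coe_iff.1 (h1.trans h)) (not_le.2 hpw)

lemma le_abs_sub_coe {b : EReal} {x ε : ℝ}
    (h : ENNReal.ofReal ε ≤ (b - (x : EReal)).abs) :
    ((x + ε : ℝ) : EReal) ≤ b ∨ b ≤ ((x - ε : ℝ) : EReal) := by
  induction b with
  | bot => exact Or.inr bot_le
  | top => exact Or.inl le_top
  | coe z =>
    rw [← EReal.coe_sub, EReal.abs_def, ENNReal.ofReal_le_ofReal_iff (abs_nonneg _), le_abs] at h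
    rw [EReal.coe_le_coe_iff, EReal.coe_le_coe_iff]
    exact h.imp (fun h => by linarith) (fun h => by linarith)

lemma real_le_sum_indicator_le_of_Phi {Ω : Type*} [MeasurableSpace Ω] {Q : Measure Ω}
    [IsProbabilityMeasure Q] {n : ℕ} {A : Fin n → Set Ω} {x ε : ℝ}
    (hA : ∀ j, NullMeasurableSet (A j) Q)
    (hind : iIndepFun (fun j => (A j).indicator fun _ => (1 : ℝ)) Q)
    (hAp : ∀ j, Q.real (A j) = Phi x) (hε0 : 0 ≤ ε) (hε : ε ≤ √(2 * π)) :
    Q.real {ω | n * Phi (x + ε) ≤ ∑ j, (A j).indicator (fun _ => (1 : ℝ)) ω}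
      ≤ exp (-(min (Phi x) (1 - Phi x) / (6 * π) * n * ε ^ 2)) := by
  refine (real_le_sum_indicator_le hA hind hAp (Phi_pos x)
    (strictMono_Phi.monotone (le_add_of_nonneg_right hε0)) (Phi_lt_one _)).trans ?_
  rw [exp_le_exp, neg_le_neg_iff]
  have := mul_le_mul_of_nonneg_left (min_mul_sq_le_exponent (x := x) hε0 hε)
    (Nat.cast_nonneg' (α := ℝ) n)
  linarith

lemma iIndepFun_indicator_preimage {Ω V : Type*} [MeasurableSpace Ω] [MeasurableSpace V]
    {Q : Measure Ω} {n : ℕ} {S : Fin n → Ω → V} (h : iIndepFun S Q) {B : Set V}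
    (hB : MeasurableSet B) :
    iIndepFun (fun j => (S j ⁻¹' B).indicator fun _ => (1 : ℝ)) Q :=
  h.comp (fun _ => B.indicator fun _ => (1 : ℝ)) fun _ => measurable_const.indicator hB

lemma one_lt_of_one_le_a {n : ℕ} {γ : ℝ} (ha : 1 ≤ a n γ) : 1 < n := by
  by_contra! h
  have : log n = 0 := by interval_cases n <;> simp
  simp [a, this] at ha
  norm_num at ha

lemma log_g_inv_nonneg {n : ℕ} {γ : ℝ} (ha : 1 ≤ a n γ) : 0 ≤ log ((g n γ)⁻¹ / 2) := by
  have h1 : phi (a n γ) ≤ 1 := by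
    rw [phi_eq]
    refine mul_le_one₀ (inv_le_one_of_one_le₀ ?_) (exp_pos _).le
      (exp_le_one_iff.2 (by nlinarith [sq_nonneg (a n γ)]))
    exact one_le_sqrt.2 (by linarith [pi_gt_three])
  have h0 := phi_pos (a n γ)
  have hg0 : 0 < g n γ := div_pos h0 (by linarith)
  have hg : g n γ ≤ 1 / 2 := by
    rw [g, div_le_iff₀ (by linarith)]
    linarith
  apply log_nonneg
  have : (1 / 2 : ℝ)⁻¹ ≤ (g n γ)⁻¹ := inv_anti₀ hg0 hg
  norm_num at this
  linarith

lemma phi_a {n : ℕ} {γ : ℝ} (hγ : 0 ≤ γ) (hn : 1 ≤ n) :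
    phi (a n γ) = (√(2 * π))⁻¹ * (n : ℝ) ^ (-(γ / 2)) := by
  have hn' : (1 : ℝ) ≤ n := by exact_mod_cast hn
  have h0 : (0 : ℝ) < n := by linarith
  rw [phi_eq, a, sq_sqrt (mul_nonneg hγ (log_nonneg hn')), rpow_def_of_pos h0]
  congr 2
  ring

/-- Both tails at `x` are at least `Φ(-a_n)`, hence at least `g(n, γ)`; and `φ(a_n)` is a multiple
of `n ^ (-γ/2)`. -/
lemma J₁_mul_le {n : ℕ} {γ x ε : ℝ} (hγ : 0 ≤ γ) (ha : 1 ≤ a n γ)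
    (hx : x ∈ Set.Icc (-a n γ) (a n γ)) :
    J₁ * ((n : ℝ) ^ (1 - γ / 2) * ε ^ 2 / √(γ * log n))
      ≤ min (Phi x) (1 - Phi x) / (6 * π) * n * ε ^ 2 := by
  have hn := one_lt_of_one_le_a ha
  have hn0 : (0 : ℝ) < n := by exact_mod_cast (zero_lt_one.trans hn)
  have ha0 : 0 < a n γ := by linarith
  have hmin : phi (a n γ) / (2 * a n γ) ≤ min (Phi x) (1 - Phi x) := by
    refine (phi_div_le_Phi_neg ha).trans (le_min (strictMono_Phi.monotone hx.1) ?_)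
    rw [← Phi_neg]
    exact strictMono_Phi.monotone (neg_le_neg hx.2)
  have e : J₁ * ((n : ℝ) ^ (1 - γ / 2) * ε ^ 2 / √(γ * log n))
      = phi (a n γ) / (2 * a n γ) / (6 * π) * n * ε ^ 2 := by
    rw [phi_a hγ hn.le, show √(γ * log n) = a n γ from rfl, J₁, sub_eq_add_neg,
      rpow_add hn0, rpow_one]
    field_simp
    ring
  rw [e]
  gcongr

end GaussianCopula

open GaussianCopula in
theorem mainTheorem7
    -- the pair `(X, Y)`
    {E : Type*} [MeasurableSpace E] (P : Measure E) [IsProbabilityMeasure P]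
    {d : ℕ} (X : E → Fin d → ℝ) (hX : Measurable X) (Y : E → Fin 2) (hY : Measurable Y)
    (i : Fin d) (y : Fin 2) (hy : P {e | Y e = y} ≠ 0)
    -- the sample `S 0, …, S (n - 1)`: independent copies of `(X | Y = y)`
    {Ω : Type*} [MeasurableSpace Ω] (Q : Measure Ω) [IsProbabilityMeasure Q]
    (n : ℕ) (S : Fin n → Ω → Fin d → ℝ)
    (hlaw : ∀ j, IdentDistrib (S j) X Q (cond P {e | Y e = y}))
    (hindep : iIndepFun S Q)
    (γ : ℝ) (hγ0 : 0 < γ) (hγ2 : γ < 2) (ha : 1 ≤ GaussianCopula.a n γ)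
    (ε : ℝ) (hε0 : 0 < ε) (hε : ε ≤ √(2 * π))
    (t : ℝ)
    (ht : GaussianCopula.alpha P X Y i y t ∈
      Set.Icc (-(GaussianCopula.a n γ : EReal)) (GaussianCopula.a n γ : EReal)) :
    Q.real {ω | ENNReal.ofReal ε ≤
        (GaussianCopula.alphaHat (fun j => S j ω) i t - GaussianCopula.alpha P X Y i y t).abs}
      ≤ 2 * Real.exp (-(min (GaussianCopula.F P X Y i y t) (1 - GaussianCopula.F P X Y i y t)
            / (6 * π) * n * ε ^ 2))
        + 6 * Real.log ((GaussianCopula.g n γ)⁻¹ / 2)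
          * Real.exp (-(1 / 32 * (n * GaussianCopula.g n γ)))
    ∧ 2 * Real.exp (-(min (GaussianCopula.F P X Y i y t) (1 - GaussianCopula.F P X Y i y t)
            / (6 * π) * n * ε ^ 2))
        + 6 * Real.log ((GaussianCopula.g n γ)⁻¹ / 2)
          * Real.exp (-(1 / 32 * (n * GaussianCopula.g n γ)))
      ≤ 2 * Real.exp (-(GaussianCopula.J₁
            * ((n : ℝ) ^ (1 - γ / 2) * ε ^ 2 / √(γ * Real.log n))))
        + 6 * Real.log ((GaussianCopula.g n γ)⁻¹ / 2)
          * Real.exp (-(1 / 32 * (n * GaussianCopula.g n γ))) := by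
  obtain ⟨x, hx⟩ : ∃ x : ℝ, alpha P X Y i y t = x := by
    induction h : alpha P X Y i y t with
    | bot => rw [h] at ht; simpa [-EReal.coe_neg, ← EReal.coe_neg] using ht.1
    | top => rw [h] at ht; simpa using ht.2
    | coe z => exact ⟨z, rfl⟩
  have hF : F P X Y i y t = Phi x :=
    le_antisymm (le_Phi_of_PhiInv_le hx.le) (Phi_le_of_le_PhiInv hx.ge)
  have hxa : x ∈ Set.Icc (-a n γ) (a n γ) := by
    rw [hx, Set.mem_Icc, ← EReal.coe_neg, EReal.coe_le_coe_iff, EReal.coe_le_coe_iff] at ht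
    exact ht
  have hn : (0 : ℝ) < n := by exact_mod_cast zero_lt_one.trans (one_lt_of_one_le_a ha)
  rw [hx, hF]
  constructor
  · set B : Set (Fin d → ℝ) := {v | v i ≤ t} with hB_def
    have hB : MeasurableSet B := measurableSet_le (measurable_pi_apply i) measurable_const
    have hA : ∀ j, NullMeasurableSet (S j ⁻¹' B) Q := fun j =>
      (hlaw j).aemeasurable_fst.nullMeasurableSet_preimage hB
    have hprob : ∀ j, Q.real (S j ⁻¹' B) = Phi x := fun j => by
      rw [← hF, measureReal_def, (hlaw j).measure_mem_eq hB]
      rfl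
    have hprob' : ∀ j, Q.real (S j ⁻¹' Bᶜ) = Phi (-x) := fun j => by
      rw [Set.preimage_compl, probReal_compl_eq_one_sub₀ (hA j), hprob, Phi_neg]
    have hup := real_le_sum_indicator_le_of_Phi hA (iIndepFun_indicator_preimage hindep hB) hprob
      hε0.le hε
    have hlo := real_le_sum_indicator_le_of_Phi (fun j => (hA j).compl)
      (iIndepFun_indicator_preimage hindep hB.compl) hprob' hε0.le hε
    -- The minimum is symmetric under `x ↦ -x`, so both tails get the same bound.
    rw [Phi_neg x, sub_sub_cancel, min_comm] at hlo
    have hsub : {ω | ENNReal.ofReal ε ≤ (alphaHat (fun j => S j ω) i t - (x : EReal)).abs}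
        ⊆ {ω | n * Phi (x + ε) ≤ ∑ j, (S j ⁻¹' B).indicator (fun _ => (1 : ℝ)) ω}
          ∪ {ω | n * Phi (-x + ε) ≤ ∑ j, (S j ⁻¹' Bᶜ).indicator (fun _ => (1 : ℝ)) ω} := by
      intro ω hω
      have hsum : FHat (fun j => S j ω) i t
          = 1 / n * ∑ j, (S j ⁻¹' B).indicator (fun _ => (1 : ℝ)) ω := rfl
      rcases le_abs_sub_coe hω with h | h
      · left
        have := Phi_le_of_le_PhiInv h
        rw [hsum, one_div, ← div_eq_inv_mul, le_div_iff₀' hn] at this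
        exact this
      · right
        have := le_Phi_of_PhiInv_le h
        rw [hsum, one_div, ← div_eq_inv_mul, div_le_iff₀' hn] at this
        have hc : ∑ j, (S j ⁻¹' Bᶜ).indicator (fun _ => (1 : ℝ)) ω
            = n - ∑ j, (S j ⁻¹' B).indicator (fun _ => (1 : ℝ)) ω := by
          simp only [Set.preimage_compl, Set.indicator_compl, Pi.sub_apply,
            Finset.sum_sub_distrib]
          simp
        have e : -x + ε = -(x - ε) := by ring
        rw [Set.mem_ofPred_eq, hc, e, Phi_neg]
        linarith
    have hlog : 0 ≤ 6 * Real.log ((g n γ)⁻¹ / 2) * Real.exp (-(1 / 32 * (n * g n γ))) :=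
      mul_nonneg (mul_nonneg (by norm_num) (log_g_inv_nonneg ha)) (exp_pos _).le
    have h := (measureReal_mono hsub (measure_ne_top Q _)).trans (measureReal_union_le _ _)
    refine h.trans ?_
    refine (add_le_add hup hlo).trans ?_
    rw [← two_mul]
    exact le_add_of_nonneg_right hlog
  · have h := J₁_mul_le (ε := ε) hγ0.le ha hxa
    gcongr
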